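/- Conventions: $L^2(\mathbb{R})$ is the space of complex-valued square-integrable functions on $\mathbb{R}$, $\langle f,g\rangle=\int f\,\overline{g}$, and $\widehat{f}$ is the $L^2$ Fourier transform, $\widehat f(\xi)=\int f(t)e^{-2\pi i t\xi}\,dt$ for $f \in L^1(\mathbb{R})\cap L^2(\mathbb{R})$. For $p>1$ and $h\in L^2(\mathbb{R})$ with $\|h\|_2=1$, the $p$-dispersion of $h$ is $$\Delta_p(h)=\min_{a\in\mathbb{R}}\Big(\int_{\mathbb{R}}|t-a|^p|h(t)|^2\,dt\Big)^{1/2}\in[0,\infty],$$ and, if $\Delta_p(h)<\infty$, the $p$-mean $\mu_p(h)\in\mathbb{R}$ of $h$ is the unique $a\in\mathbb{R}$ at which this minimum is attained. Theorem. Fix $A,B,C>0$, $p,q>1$ and $r,s>0$. Let $\{e_n\}_{n=1}^\infty\subset L^2(\mathbb{R})$ satisfy $\|e_n\|_2=1$ for all $n$ and $$\forall f\in L^2(\mathbb{R}),\qquad B\Big(\sum_{n=1}^\infty|\langle f,e_n\rangle|^s\Big)^{1/s}\le\|f\|_2\le C\Big(\sum_{n=1}^\infty|\langle f,e_n\rangle|^r\Big)^{1/r},$$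 where the sums take values in $[0,\infty]$. If $qr>2$, then it is not possible that $$\forall n\in\mathbb{N},\qquad |\mu_p(e_n)|\le A,\quad \Delta_p(e_n)\le A\quad\text{and}\quad \Delta_q(\widehat{e_n})\le A.$$ -/

import Mathlib

open MeasureTheory
open scoped ENNReal FourierTransform

/-- The space `L²(ℝ)` of complex-valued square-integrable functions on the line. -/
abbrev L2R : Type := Lp ℂ 2 (volume : Measure ℝ)

/-- The `p`-th absolute moment of `|h|²` about `a`, that is `∫ |t - a|^p |h(t)|² dt ∈ [0, ∞]`. -/
noncomputable def powerMoment (p : ℝ) (h : ℝ → ℂ) (a : ℝ) : ℝ≥0∞ :=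
  ∫⁻ t : ℝ, ENNReal.ofReal (|t - a| ^ p) * ‖h t‖ₑ ^ 2

/-- The `p`-dispersion `Δ_p(h) = min_a (∫ |t - a|^p |h(t)|² dt)^{1/2} ∈ [0, ∞]`;
it is `∞` exactly when all these integrals diverge. -/
noncomputable def pDispersion (p : ℝ) (h : ℝ → ℂ) : ℝ≥0∞ :=
  ⨅ a : ℝ, powerMoment p h a ^ (1 / 2 : ℝ)

open Classical in
/-- The `p`-mean `μ_p(h) = argmin_a (∫ |t - a|^p |h(t)|² dt)^{1/2}`. For `p > 1` and `‖h‖₂ = 1` the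
minimizer exists and is unique whenever `Δ_p(h) < ∞`; the value is meaningful only then. -/
noncomputable def pMean (p : ℝ) (h : ℝ → ℂ) : ℝ :=
  if H : ∃ a : ℝ, ∀ b : ℝ, powerMoment p h a ^ (1 / 2 : ℝ) ≤ powerMoment p h b ^ (1 / 2 : ℝ)
  then H.choose else 0

/-! Suppose every `e n` is localized. Bounded time mean and dispersions put most of the mass of `e
n` in a fixed time interval and most of that of its transform within a fixed distance of its mean `m
n`. So `e n` correlates, uniformly in `n`, with an exponential cut off to that interval whose
frequency lies on a fixed grid, at index `j n` (`exists_frequency_grid`). These exponentials have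
equal norms, so the `ℓˢ` bound lets each grid point serve boundedly many `n`; since `q * r / 2 > 1`,
the sum of `(1 + |j n|) ^ (-(q * r / 2))` over `n` converges (`summable_comp_of_le_norm_inner`). Now
test the `ℓʳ` bound on unit vectors `f x` whose transform is the indicator of `[0, 1]` times an
exponential of frequency `x`. The moment bound gives `|⟨e n, f x⟩|^r` at most a constant times that
summable sequence, uniformly in `x`, and Riemann–Lebesgue sends each term to `0` as `|x| → ∞`. By
dominated convergence the whole sum tends to `0`, contradicting `‖f x‖ = 1`. -/

open Filter Topology

/-! ### Moments: existence of the mean and tail bounds. -/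

section Moments

/-- Fatou's lemma; finiteness of the moments is not needed. -/
theorem lowerSemicontinuous_powerMoment {p : ℝ} (hp : 0 < p) {h : ℝ → ℂ}
    (hh : AEStronglyMeasurable h volume) : LowerSemicontinuous (powerMoment p h) := by
  rw [lowerSemicontinuous_iff_le_liminf]
  intro a
  refine le_trans ?_ (lintegral_liminf_le' (f := fun b t ↦
    ENNReal.ofReal (|t - b| ^ p) * ‖h t‖ₑ ^ 2) fun b ↦ ?_)
  · refine lintegral_mono fun t ↦ ?_
    have hc : Continuous fun b : ℝ ↦ ENNReal.ofReal (|t - b| ^ p) :=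
      ENNReal.continuous_ofReal.comp
        ((continuous_const.sub continuous_id).abs.rpow_const fun _ ↦ Or.inr hp.le)
    exact (ENNReal.Tendsto.mul_const (hc.tendsto a) (Or.inr (by finiteness))).liminf_eq.ge
  · have : Measurable fun t : ℝ ↦ ENNReal.ofReal (|t - b| ^ p) := by fun_prop
    exact this.aemeasurable.mul (hh.enorm.pow_const 2)

theorem rpow_add_le_two_rpow_mul {p x y : ℝ} (hp : 0 < p) (hx : 0 ≤ x) (hy : 0 ≤ y) :
    (x + y) ^ p ≤ 2 ^ p * (x ^ p + y ^ p) := by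
  have h1 : (x + y) ^ p ≤ (2 * max x y) ^ p := by
    refine Real.rpow_le_rpow (by positivity) ?_ hp.le
    linarith [le_max_left x y, le_max_right x y]
  rw [Real.mul_rpow (by norm_num) (by positivity)] at h1
  refine h1.trans (mul_le_mul_of_nonneg_left ?_ (by positivity))
  rcases max_cases x y with h | h <;> rw [h.1]
  · linarith [Real.rpow_nonneg hy p]
  · linarith [Real.rpow_nonneg hx p]

theorem ofReal_rpow_mul_mass_le {p : ℝ} (hp : 0 < p) {h : ℝ → ℂ}
    (hh : AEStronglyMeasurable h volume) (a b : ℝ) :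
    ENNReal.ofReal (|a - b| ^ p) * ∫⁻ t, ‖h t‖ₑ ^ 2 ≤
      ENNReal.ofReal (2 ^ p) * (powerMoment p h a + powerMoment p h b) := by
  have hm (c : ℝ) : AEMeasurable
      (fun t : ℝ ↦ ENNReal.ofReal (|t - c| ^ p) * ‖h t‖ₑ ^ 2) volume := by
    have : Measurable fun t : ℝ ↦ ENNReal.ofReal (|t - c| ^ p) := by fun_prop
    exact this.aemeasurable.mul (hh.enorm.pow_const 2)
  unfold powerMoment
  rw [← lintegral_add_left' (hm a), ← lintegral_const_mul' _ _ ENNReal.ofReal_ne_top,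
    ← lintegral_const_mul' _ _ ENNReal.ofReal_ne_top]
  refine lintegral_mono fun t ↦ ?_
  dsimp only
  rw [← add_mul, ← mul_assoc, ← ENNReal.ofReal_add (by positivity) (by positivity),
    ← ENNReal.ofReal_mul (by positivity)]
  gcongr
  refine le_trans ?_ (rpow_add_le_two_rpow_mul hp (abs_nonneg _) (abs_nonneg _))
  gcongr
  rw [abs_sub_comm t a]
  exact abs_sub_le a t b

/-- Sublevel sets of the moment are bounded, by the triangle inequality and unit mass, so lower
semicontinuity on a closed ball suffices. -/
theorem exists_forall_powerMoment_le {p : ℝ} (hp : 0 < p) {h : ℝ → ℂ}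
    (hh : AEStronglyMeasurable h volume) (h1 : ∫⁻ t, ‖h t‖ₑ ^ 2 = 1) :
    ∃ a, ∀ b, powerMoment p h a ≤ powerMoment p h b := by
  by_cases hfin : ∃ a, powerMoment p h a ≠ ∞
  swap
  · push Not at hfin
    exact ⟨0, fun b ↦ by rw [hfin b]; exact le_top⟩
  obtain ⟨a, ha⟩ := hfin
  set L := (2 ^ p * (2 * (powerMoment p h a).toReal)) ^ (1 / p)
  have key : ∀ b, powerMoment p h b ≤ powerMoment p h a → b ∈ Metric.closedBall a L := by
    intro b hb
    have h2 := ofReal_rpow_mul_mass_le hp hh b a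
    rw [h1, mul_one] at h2
    have h3 : ENNReal.ofReal (|b - a| ^ p) ≤
        ENNReal.ofReal (2 ^ p * (2 * (powerMoment p h a).toReal)) := by
      refine h2.trans ?_
      rw [ENNReal.ofReal_mul (by positivity), ENNReal.ofReal_mul (by positivity),
        ENNReal.ofReal_toReal ha]
      gcongr
      rw [ENNReal.ofReal_ofNat, two_mul]
      gcongr
    rw [ENNReal.ofReal_le_ofReal_iff (by positivity)] at h3
    rw [Metric.mem_closedBall, Real.dist_eq]
    calc |b - a| = (|b - a| ^ p) ^ (1 / p) := by
          rw [← Real.rpow_mul (abs_nonneg _), mul_one_div_cancel hp.ne', Real.rpow_one]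
      _ ≤ L := Real.rpow_le_rpow (by positivity) h3 (by positivity)
  obtain ⟨c, -, hc⟩ := ((lowerSemicontinuous_powerMoment hp hh).lowerSemicontinuousOn
    (Metric.closedBall a L)).exists_isMinOn ⟨a, key a le_rfl⟩ (isCompact_closedBall a L)
  refine ⟨c, fun b ↦ ?_⟩
  rcases le_total (powerMoment p h b) (powerMoment p h a) with hb | hb
  · exact hc (key b hb)
  · exact le_trans (hc (key a le_rfl)) hb

/-- Since a minimizer exists, `pMean` is never its default value here. -/
theorem powerMoment_pMean_le {p : ℝ} (hp : 0 < p) {h : ℝ → ℂ}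
    (hh : AEStronglyMeasurable h volume) (h1 : ∫⁻ t, ‖h t‖ₑ ^ 2 = 1) {D : ℝ≥0∞}
    (hD : pDispersion p h ≤ D) : powerMoment p h (pMean p h) ≤ D ^ 2 := by
  have H : ∃ a : ℝ, ∀ b : ℝ, powerMoment p h a ^ (1 / 2 : ℝ) ≤ powerMoment p h b ^ (1 / 2 : ℝ) := by
    obtain ⟨a, ha⟩ := exists_forall_powerMoment_le hp hh h1
    exact ⟨a, fun b ↦ ENNReal.rpow_le_rpow (ha b) (by norm_num)⟩
  have h2 : powerMoment p h (pMean p h) ^ (1 / 2 : ℝ) ≤ D := by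
    refine le_trans (le_iInf fun b ↦ ?_) hD
    rw [pMean, dif_pos H]
    exact H.choose_spec b
  calc powerMoment p h (pMean p h) = (powerMoment p h (pMean p h) ^ (1 / 2 : ℝ)) ^ 2 := by
        rw [← ENNReal.rpow_mul_natCast]; norm_num
    _ ≤ D ^ 2 := by gcongr

theorem ofReal_rpow_mul_tail_le {p : ℝ} (hp : 0 < p) (h : ℝ → ℂ) (a : ℝ) {R : ℝ} (hR : 0 ≤ R)
    {S : Set ℝ} (hS : MeasurableSet S) (hSR : ∀ t ∈ S, R ≤ |t - a|) :
    ENNReal.ofReal (R ^ p) * ∫⁻ t in S, ‖h t‖ₑ ^ 2 ≤ powerMoment p h a := by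
  rw [← lintegral_const_mul' _ _ ENNReal.ofReal_ne_top]
  refine le_trans (setLIntegral_mono' hS fun t ht ↦ ?_) (setLIntegral_le_lintegral S _)
  gcongr
  exact hSR t ht

/-- A bounded moment makes the tails uniformly small. -/
theorem exists_radius_tail_le {p : ℝ} (hp : 0 < p) {K : ℝ≥0∞} (hK : K ≠ ∞) {ε : ℝ≥0∞}
    (hε : ε ≠ 0) :
    ∃ R : ℝ, 0 < R ∧ ∀ (h : ℝ → ℂ) (a : ℝ), powerMoment p h a ≤ K →
      ∀ S : Set ℝ, MeasurableSet S → (∀ t ∈ S, R ≤ |t - a|) → ∫⁻ t in S, ‖h t‖ₑ ^ 2 ≤ ε := by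
  have h1 : Tendsto (fun R : ℝ ↦ ENNReal.ofReal (R ^ p)) atTop (𝓝 ∞) :=
    ENNReal.tendsto_ofReal_atTop.comp (tendsto_rpow_atTop hp)
  have h2 : K / ε < ∞ := ENNReal.div_lt_top hK hε
  obtain ⟨R, hR0, hR⟩ := ((eventually_gt_atTop (0 : ℝ)).and (h1.eventually (lt_mem_nhds h2))).exists
  refine ⟨R, hR0, fun h a ha S hS hSR ↦ ?_⟩
  have h3 := (ofReal_rpow_mul_tail_le hp h a hR0.le hS hSR).trans ha
  have hpos : ENNReal.ofReal (R ^ p) ≠ 0 := by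
    have : 0 < R ^ p := by positivity
    simpa using this
  rw [mul_comm] at h3
  calc ∫⁻ t in S, ‖h t‖ₑ ^ 2 ≤ K / ENNReal.ofReal (R ^ p) :=
        (ENNReal.le_div_iff_mul_le (Or.inl hpos) (Or.inl ENNReal.ofReal_ne_top)).2 h3
    _ ≤ ε := by
        refine ENNReal.div_le_of_le_mul ?_
        rcases eq_or_ne ε ∞ with rfl | hε'
        · simp [ENNReal.top_mul hpos]
        · rw [mul_comm]
          exact (ENNReal.div_le_iff hε hε').1 hR.le

end Moments

/-! ### The Fourier transform on `L¹ ∩ L²`. -/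

section Fourier

open scoped ContDiff

/-- The `L²` Fourier transform of an integrable function is given by the Fourier integral. -/
theorem fourier_coeFn_ae_eq (f : L2R) (hf : Integrable f) :
    ((𝓕 f : L2R) : ℝ → ℂ) =ᵐ[volume] 𝓕 (f : ℝ → ℂ) := by
  have hcont : Continuous (𝓕 (f : ℝ → ℂ)) :=
    VectorFourier.fourierIntegral_continuous Real.continuous_fourierChar
      (L := innerₗ ℝ) continuous_inner hf
  -- Both sides agree against test functions, because each transform can be moved onto the test
  -- function.
  refine ae_eq_of_integral_contDiff_smul_eq ((Lp.memLp _).locallyIntegrable (by norm_num))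
    hcont.locallyIntegrable fun g g_smooth g_cpt ↦ ?_
  have hg₁ : HasCompactSupport (Complex.ofRealCLM ∘ g) := g_cpt.comp_left rfl
  have hg₂ : ContDiff ℝ ∞ (Complex.ofRealCLM ∘ g) := by fun_prop
  set G := hg₁.toSchwartzMap hg₂ with hG
  have hGg : ∀ x, G x = (g x : ℂ) := fun x ↦ rfl
  have h1 : ∫ x, G x • (𝓕 f : L2R) x = ∫ x, (𝓕 G) x • f x := by
    rw [← Lp.toTemperedDistribution_apply, ← Lp.toTemperedDistribution_apply,
      ← Lp.fourier_toTemperedDistribution_eq, TemperedDistribution.fourier_apply]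
  have h2 : ∫ x, (𝓕 (G : ℝ → ℂ)) x • f x = ∫ x, G x • (𝓕 (f : ℝ → ℂ)) x := by
    simpa using! VectorFourier.integral_fourierIntegral_smul_eq_flip (L := innerₗ ℝ)
      Real.continuous_fourierChar continuous_inner G.integrable hf
  have h3 := h1.trans h2
  simpa [hGg] using h3

end Fourier

/-! ### Exponentials cut off to an interval. -/

section Window

theorem lintegral_enorm_sq_eq (f : L2R) : ∫⁻ t, ‖f t‖ₑ ^ 2 = ‖f‖ₑ ^ 2 := by
  rw [Lp.enorm_def, eLpNorm_eq_lintegral_rpow_enorm_toReal (by norm_num) (by norm_num),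
    ← ENNReal.rpow_natCast, ← ENNReal.rpow_mul]
  norm_num

theorem enorm_fourierChar (x : ℝ) : ‖(Real.fourierChar x : ℂ)‖ₑ = 1 := by
  rw [← ofReal_norm, Circle.norm_coe, ENNReal.ofReal_one]

theorem memLp_window (a b ξ : ℝ) :
    MemLp ((Set.Icc a b).indicator fun t : ℝ ↦ (Real.fourierChar (t * ξ) : ℂ)) 2 volume := by
  refine memLp_indicator_iff_restrict measurableSet_Icc |>.2 ?_
  refine MemLp.of_bound (Continuous.aestronglyMeasurable (by fun_prop)) 1
    (Eventually.of_forall fun t ↦ (Circle.norm_coe _).le)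

/-- The exponential `t ↦ exp (2πi ξ t)` cut off to the interval `[a, b]`. -/
noncomputable def windowExp (a b ξ : ℝ) : L2R := (memLp_window a b ξ).toLp _

theorem coeFn_windowExp (a b ξ : ℝ) : windowExp a b ξ =ᵐ[volume]
    (Set.Icc a b).indicator fun t : ℝ ↦ (Real.fourierChar (t * ξ) : ℂ) :=
  MemLp.coeFn_toLp _

theorem enorm_windowExp_sq (a b ξ : ℝ) : ‖windowExp a b ξ‖ₑ ^ 2 = ENNReal.ofReal (b - a) := by
  rw [← lintegral_enorm_sq_eq, ← Real.volume_Icc, ← lintegral_indicator_one measurableSet_Icc]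
  refine lintegral_congr_ae ?_
  filter_upwards [coeFn_windowExp a b ξ] with t ht
  rw [ht]
  by_cases h : t ∈ Set.Icc a b <;> simp [h, enorm_fourierChar]

theorem inner_windowExp (a b ξ : ℝ) (f : L2R) :
    inner ℂ (windowExp a b ξ) f = 𝓕 ((Set.Icc a b).indicator (f : ℝ → ℂ)) ξ := by
  rw [L2.inner_def, Real.fourier_real_eq]
  refine integral_congr_ae ?_
  filter_upwards [coeFn_windowExp a b ξ] with t ht
  rw [ht]
  by_cases h : t ∈ Set.Icc a b
  · simp [h, Circle.smul_def, mul_comm, ← Circle.coe_inv_eq_conj, AddChar.map_neg_eq_inv]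
  · simp [h]

theorem norm_fourierChar_sub_le (x y : ℝ) :
    ‖(Real.fourierChar x : ℂ) - Real.fourierChar y‖ ≤ 2 * Real.pi * |x - y| := by
  have h : (Real.fourierChar x : ℂ) - Real.fourierChar y =
      Real.fourierChar y * (Real.fourierChar (x - y) - 1) := by
    rw [mul_sub, mul_one, ← Circle.coe_mul, ← AddChar.map_add_eq_mul, add_sub_cancel]
  rw [h, norm_mul, Circle.norm_coe, one_mul, Real.fourierChar_apply, mul_comm]
  refine (Real.norm_exp_I_mul_ofReal_sub_one_le).trans ?_
  rw [norm_mul, norm_mul, Real.norm_eq_abs Real.pi, abs_of_pos Real.pi_pos]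
  simp

theorem exists_forall_norm_windowExp_sub_le {T c : ℝ} (hT : 0 < T) (hc : 0 < c) :
    ∃ δ, 0 < δ ∧ ∀ ξ η : ℝ, |ξ - η| ≤ δ →
      ‖windowExp (-T) T ξ - windowExp (-T) T η‖ ≤ c := by
  -- The squared norm is at most `(2πTδ)² * 2T`; using `2T ≤ (2T + 1)²` avoids a square root.
  refine ⟨c / (2 * Real.pi * T * (2 * T + 1)), by positivity, fun ξ η h ↦ ?_⟩
  set δ := c / (2 * Real.pi * T * (2 * T + 1)) with hδ
  have hδ0 : 0 < δ := by positivity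
  have h1 : ‖windowExp (-T) T ξ - windowExp (-T) T η‖ₑ ^ 2 ≤ ENNReal.ofReal c ^ 2 := by
    rw [← lintegral_enorm_sq_eq]
    calc ∫⁻ t, ‖(windowExp (-T) T ξ - windowExp (-T) T η : L2R) t‖ₑ ^ 2
        ≤ ∫⁻ t, (Set.Icc (-T) T).indicator
            (fun _ ↦ ENNReal.ofReal (2 * Real.pi * T * δ) ^ 2) t := by
          refine lintegral_mono_ae ?_
          filter_upwards [coeFn_windowExp (-T) T ξ, coeFn_windowExp (-T) T η,
            Lp.coeFn_sub (windowExp (-T) T ξ) (windowExp (-T) T η)] with t h1 h2 h3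
          rw [h3, Pi.sub_apply, h1, h2]
          by_cases ht : t ∈ Set.Icc (-T) T
          · simp only [Set.indicator_of_mem ht]
            gcongr
            rw [← ofReal_norm]
            refine ENNReal.ofReal_le_ofReal ((norm_fourierChar_sub_le _ _).trans ?_)
            rw [← mul_sub, abs_mul, mul_assoc _ T δ]
            gcongr
            exact abs_le.2 ht
          · simp [Set.indicator_of_notMem ht]
      _ = ENNReal.ofReal ((2 * Real.pi * T * δ) ^ 2 * (2 * T)) := by
          rw [lintegral_indicator_const measurableSet_Icc, Real.volume_Icc,
            ← ENNReal.ofReal_pow (by positivity), ← ENNReal.ofReal_mul (by positivity)]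
          congr 1; ring
      _ ≤ ENNReal.ofReal c ^ 2 := by
          rw [← ENNReal.ofReal_pow hc.le]
          refine ENNReal.ofReal_le_ofReal ?_
          have : c = 2 * Real.pi * T * δ * (2 * T + 1) := by
            rw [hδ]; field_simp
          rw [this, mul_pow _ (2 * T + 1)]
          gcongr
          nlinarith
  rw [ENNReal.pow_le_pow_left_iff (by norm_num), ← ofReal_norm,
    ENNReal.ofReal_le_ofReal_iff hc.le] at h1
  exact h1

/-- Cauchy–Schwarz on an interval of length one. The bound does not depend on `ξ`, which later gives
the dominating sequence. -/
theorem enorm_inner_windowExp_zero_one_sq_le (ξ : ℝ) (f : L2R) :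
    ‖inner ℂ (windowExp 0 1 ξ) f‖ₑ ^ 2 ≤ ∫⁻ t in Set.Icc 0 1, ‖f t‖ₑ ^ 2 := by
  have hf : AEStronglyMeasurable f (volume.restrict (Set.Icc (0 : ℝ) 1)) :=
    (Lp.aestronglyMeasurable f).restrict
  have : IsProbabilityMeasure (volume.restrict (Set.Icc (0 : ℝ) 1)) := ⟨by simp⟩
  have h1 : ‖inner ℂ (windowExp 0 1 ξ) f‖ₑ ≤
      eLpNorm f 1 (volume.restrict (Set.Icc (0 : ℝ) 1)) := by
    rw [inner_windowExp, Real.fourier_real_eq]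
    refine (enorm_integral_le_lintegral_enorm _).trans ?_
    rw [eLpNorm_one_eq_lintegral_enorm, ← lintegral_indicator measurableSet_Icc]
    refine lintegral_mono fun t ↦ ?_
    by_cases ht : t ∈ Set.Icc (0 : ℝ) 1 <;> simp [ht, enorm_fourierChar, Circle.smul_def]
  have h2 := h1.trans (eLpNorm_le_eLpNorm_of_exponent_le (p := 1) (q := 2) (by norm_num) hf)
  calc ‖inner ℂ (windowExp 0 1 ξ) f‖ₑ ^ 2
      ≤ eLpNorm f 2 (volume.restrict (Set.Icc (0 : ℝ) 1)) ^ 2 := by gcongr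
    _ = _ := by
      rw [eLpNorm_eq_lintegral_rpow_enorm_toReal (by norm_num) (by norm_num),
        ← ENNReal.rpow_natCast, ← ENNReal.rpow_mul]
      norm_num

theorem integrable_indicator_Icc (f : L2R) (a b : ℝ) :
    Integrable ((Set.Icc a b).indicator (f : ℝ → ℂ)) :=
  (integrable_indicator_iff measurableSet_Icc).2
    (((Lp.memLp f).restrict _).integrable (by norm_num))

/-- Plancherel applied to the part of `f` outside the interval. -/
theorem lintegral_fourier_sub_fourier_indicator (f : L2R) (a b : ℝ) :
    ∫⁻ ξ, ‖(𝓕 f : L2R) ξ - 𝓕 ((Set.Icc a b).indicator (f : ℝ → ℂ)) ξ‖ₑ ^ 2 =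
      ∫⁻ t in (Set.Icc a b)ᶜ, ‖f t‖ₑ ^ 2 := by
  set g : L2R := ((Lp.memLp f).indicator (measurableSet_Icc (a := a) (b := b))).toLp _
  have hg : g =ᵐ[volume] (Set.Icc a b).indicator (f : ℝ → ℂ) := MemLp.coeFn_toLp _
  have hF : (𝓕 (g : ℝ → ℂ)) = 𝓕 ((Set.Icc a b).indicator (f : ℝ → ℂ)) := by
    ext ξ
    rw [Real.fourier_real_eq, Real.fourier_real_eq]
    refine integral_congr_ae ?_
    filter_upwards [hg] with t ht
    rw [ht]
  have hG := fourier_coeFn_ae_eq g ((integrable_congr hg).2 (integrable_indicator_Icc f a b))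
  rw [hF] at hG
  have hsub : (𝓕 f : L2R) - 𝓕 g = 𝓕 (f - g) :=
    (map_sub (Lp.fourierTransformₗᵢ ℝ ℂ) f g).symm
  calc ∫⁻ ξ, ‖(𝓕 f : L2R) ξ - 𝓕 ((Set.Icc a b).indicator (f : ℝ → ℂ)) ξ‖ₑ ^ 2
      = ∫⁻ ξ, ‖(𝓕 (f - g) : L2R) ξ‖ₑ ^ 2 := by
        refine lintegral_congr_ae ?_
        rw [← hsub]
        filter_upwards [hG, Lp.coeFn_sub (𝓕 f : L2R) (𝓕 g)] with ξ h1 h2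
        rw [h2, Pi.sub_apply, h1]
    _ = ∫⁻ t, ‖(f - g : L2R) t‖ₑ ^ 2 := by
        rw [lintegral_enorm_sq_eq, lintegral_enorm_sq_eq, ← ofReal_norm, ← ofReal_norm,
          Lp.norm_fourier_eq]
    _ = ∫⁻ t in (Set.Icc a b)ᶜ, ‖f t‖ₑ ^ 2 := by
        rw [← lintegral_indicator measurableSet_Icc.compl]
        refine lintegral_congr_ae ?_
        filter_upwards [hg, Lp.coeFn_sub f g] with t h1 h2
        rw [h2, Pi.sub_apply, h1]
        by_cases ht : t ∈ Set.Icc a b <;> simp only [Set.indicator, Set.mem_compl_iff, ht] <;> simp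

theorem enorm_sq_le_two_mul (x y : ℂ) : ‖x‖ₑ ^ 2 ≤ 2 * ‖y‖ₑ ^ 2 + 2 * ‖x - y‖ₑ ^ 2 := by
  simp only [← ofReal_norm]
  rw [← ENNReal.ofReal_pow (norm_nonneg _), ← ENNReal.ofReal_pow (norm_nonneg _),
    ← ENNReal.ofReal_pow (norm_nonneg _), ← ENNReal.ofReal_ofNat 2,
    ← ENNReal.ofReal_mul (by norm_num), ← ENNReal.ofReal_mul (by norm_num),
    ← ENNReal.ofReal_add (by positivity) (by positivity)]
  refine ENNReal.ofReal_le_ofReal ?_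
  have h : ‖x‖ ≤ ‖y‖ + ‖x - y‖ := by simpa using norm_add_le y (x - y)
  nlinarith [norm_nonneg x, norm_nonneg y, norm_nonneg (x - y), sq_nonneg (‖y‖ - ‖x - y‖)]

/-- A unit vector concentrated in time and frequency correlates with a windowed exponential
whose frequency lies in the frequency window. -/
theorem exists_le_norm_inner_windowExp {f : L2R} (hf : ‖f‖ = 1) {T R m c : ℝ} (hc : 0 < c)
    (hcR : 8 * R * c ^ 2 ≤ 1)
    (htime : ∫⁻ t in (Set.Icc (-T) T)ᶜ, ‖f t‖ₑ ^ 2 ≤ ENNReal.ofReal (1 / 16))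
    (hfreq : ∫⁻ ξ in (Set.Icc (m - R) (m + R))ᶜ, ‖(𝓕 f : L2R) ξ‖ₑ ^ 2 ≤
      ENNReal.ofReal (1 / 16)) :
    ∃ ξ ∈ Set.Icc (m - R) (m + R), c ≤ ‖inner ℂ (windowExp (-T) T ξ) f‖ := by
  by_contra! hcon
  set G := 𝓕 ((Set.Icc (-T) T).indicator (f : ℝ → ℂ)) with hG
  set W := Set.Icc (m - R) (m + R)
  have hW : MeasurableSet W := measurableSet_Icc
  have hGcont : Continuous G :=
    VectorFourier.fourierIntegral_continuous Real.continuous_fourierChar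
      (L := innerₗ ℝ) continuous_inner (integrable_indicator_Icc f (-T) T)
  have hGW : ∫⁻ ξ in W, ‖G ξ‖ₑ ^ 2 ≤ ENNReal.ofReal (1 / 4) := by
    calc ∫⁻ ξ in W, ‖G ξ‖ₑ ^ 2 ≤ ∫⁻ ξ in W, ENNReal.ofReal (c ^ 2) := by
          refine setLIntegral_mono' hW fun ξ hξ ↦ ?_
          rw [ENNReal.ofReal_pow hc.le]
          gcongr
          rw [← ofReal_norm, hG, ← inner_windowExp]
          exact ENNReal.ofReal_le_ofReal (hcon ξ hξ).le
      _ = ENNReal.ofReal (c ^ 2 * (2 * R)) := by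
          rw [setLIntegral_const, Real.volume_Icc, ENNReal.ofReal_mul (by positivity)]
          congr 2; ring
      _ ≤ _ := ENNReal.ofReal_le_ofReal (by linarith)
  have hone : ∫⁻ ξ, ‖(𝓕 f : L2R) ξ‖ₑ ^ 2 = 1 := by
    rw [lintegral_enorm_sq_eq, ← ofReal_norm, Lp.norm_fourier_eq, hf]; simp
  -- If all correlations on `W` were below `c`, the total mass would be at most `2/4 + 2/16 + 1/16`.
  have hmain : (1 : ℝ≥0∞) ≤ ENNReal.ofReal (11 / 16) := by
    calc (1 : ℝ≥0∞) = (∫⁻ ξ in W, ‖(𝓕 f : L2R) ξ‖ₑ ^ 2) + ∫⁻ ξ in Wᶜ, ‖(𝓕 f : L2R) ξ‖ₑ ^ 2 := by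
          rw [lintegral_add_compl _ hW, hone]
      _ ≤ (2 * (∫⁻ ξ in W, ‖G ξ‖ₑ ^ 2) + 2 * ∫⁻ ξ in W, ‖(𝓕 f : L2R) ξ - G ξ‖ₑ ^ 2) +
            ENNReal.ofReal (1 / 16) := by
          gcongr
          have hm : Measurable fun ξ ↦ ‖G ξ‖ₑ ^ 2 := hGcont.measurable.enorm.pow_const 2
          rw [← lintegral_const_mul' _ _ (by norm_num), ← lintegral_const_mul' _ _ (by norm_num),
            ← lintegral_add_left (hm.const_mul 2)]
          exact lintegral_mono fun ξ ↦ enorm_sq_le_two_mul _ _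
      _ ≤ (2 * ENNReal.ofReal (1 / 4) + 2 * ENNReal.ofReal (1 / 16)) +
            ENNReal.ofReal (1 / 16) := by
          gcongr
          refine (setLIntegral_le_lintegral _ _).trans ?_
          rw [hG, lintegral_fourier_sub_fourier_indicator]
          exact htime
      _ = ENNReal.ofReal (11 / 16) := by
          rw [← ENNReal.ofReal_ofNat 2, ← ENNReal.ofReal_mul (by norm_num),
            ← ENNReal.ofReal_mul (by norm_num), ← ENNReal.ofReal_add (by norm_num) (by norm_num),
            ← ENNReal.ofReal_add (by norm_num) (by norm_num)]
          norm_num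
  rw [← ENNReal.ofReal_one, ENNReal.ofReal_le_ofReal_iff (by norm_num)] at hmain
  norm_num at hmain

end Window

/-! ### Frequency grid and decay near frequency zero. -/

section Decay

theorem norm_inner_windowExp_sq_mul_rpow_le {q K m : ℝ} (hq : 0 < q) (hK : 0 ≤ K) {g : L2R}
    (hg : ‖g‖ = 1) (hm : powerMoment q g m ≤ ENNReal.ofReal K) (x : ℝ) :
    ‖inner ℂ (windowExp 0 1 x) g‖ ^ 2 * (1 + |m|) ^ q ≤ 4 ^ q * (1 + K) := by
  have hpt : ∀ ξ ∈ Set.Icc (0 : ℝ) 1, (1 + |m|) ^ q ≤ 4 ^ q * (1 + |ξ - m| ^ q) := by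
    intro ξ hξ
    have h1 : 1 + |m| ≤ 2 + |ξ - m| := by
      have := abs_sub_abs_le_abs_sub m ξ
      rw [abs_sub_comm, abs_of_nonneg hξ.1] at this
      linarith [hξ.2]
    have h2 : (1 : ℝ) ≤ 2 ^ q := Real.one_le_rpow (by norm_num) hq.le
    have h3 : (4 : ℝ) ^ q = 2 ^ q * 2 ^ q := by
      rw [← Real.mul_rpow (by norm_num) (by norm_num)]; norm_num
    calc (1 + |m|) ^ q ≤ (2 + |ξ - m|) ^ q := Real.rpow_le_rpow (by positivity) h1 hq.le
      _ ≤ 2 ^ q * (2 ^ q + |ξ - m| ^ q) :=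
        rpow_add_le_two_rpow_mul hq (by norm_num) (abs_nonneg _)
      _ ≤ 4 ^ q * (1 + |ξ - m| ^ q) := by
        rw [h3, mul_assoc]
        have : 0 ≤ |ξ - m| ^ q := by positivity
        gcongr
        nlinarith
  have key : ‖inner ℂ (windowExp 0 1 x) g‖ₑ ^ 2 * ENNReal.ofReal ((1 + |m|) ^ q) ≤
      ENNReal.ofReal (4 ^ q * (1 + K)) := by
    calc ‖inner ℂ (windowExp 0 1 x) g‖ₑ ^ 2 * ENNReal.ofReal ((1 + |m|) ^ q)
        ≤ (∫⁻ t in Set.Icc 0 1, ‖g t‖ₑ ^ 2) * ENNReal.ofReal ((1 + |m|) ^ q) := by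
          gcongr; exact enorm_inner_windowExp_zero_one_sq_le x g
      _ = ∫⁻ t in Set.Icc 0 1, ENNReal.ofReal ((1 + |m|) ^ q) * ‖g t‖ₑ ^ 2 := by
          rw [lintegral_const_mul' _ _ ENNReal.ofReal_ne_top, mul_comm]
      _ ≤ ∫⁻ t in Set.Icc 0 1, ENNReal.ofReal (4 ^ q) *
            (‖g t‖ₑ ^ 2 + ENNReal.ofReal (|t - m| ^ q) * ‖g t‖ₑ ^ 2) := by
          refine setLIntegral_mono' measurableSet_Icc fun t ht ↦ ?_
          calc _ ≤ ENNReal.ofReal (4 ^ q * (1 + |t - m| ^ q)) * ‖g t‖ₑ ^ 2 := by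
                gcongr; exact hpt t ht
            _ = _ := by
                rw [ENNReal.ofReal_mul (by positivity), ENNReal.ofReal_add (by norm_num)
                  (by positivity), ENNReal.ofReal_one]
                ring
      _ ≤ ∫⁻ t, ENNReal.ofReal (4 ^ q) *
            (‖g t‖ₑ ^ 2 + ENNReal.ofReal (|t - m| ^ q) * ‖g t‖ₑ ^ 2) :=
          setLIntegral_le_lintegral _ _
      _ = ENNReal.ofReal (4 ^ q) * (1 + powerMoment q g m) := by
          rw [lintegral_const_mul' _ _ ENNReal.ofReal_ne_top, lintegral_add_left'
            ((Lp.aestronglyMeasurable g).enorm.pow_const 2), lintegral_enorm_sq_eq, ← ofReal_norm,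
            hg, ENNReal.ofReal_one, one_pow, powerMoment]
      _ ≤ ENNReal.ofReal (4 ^ q) * (1 + ENNReal.ofReal K) := by gcongr
      _ = _ := by
          rw [ENNReal.ofReal_mul (by positivity), ENNReal.ofReal_add (by norm_num) hK,
            ENNReal.ofReal_one]
  rw [← ofReal_norm, ← ENNReal.ofReal_pow (norm_nonneg _), ← ENNReal.ofReal_mul (by positivity),
    ENNReal.ofReal_le_ofReal_iff (by positivity)] at key
  exact key

/-- Unit vectors with uniformly bounded time mean and dispersions correlate with a windowed
exponential on a fixed frequency grid, and have corresponding decay near frequency zero. -/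
theorem exists_frequency_grid {A p q : ℝ} (hA : 0 < A) (hp : 0 < p) (hq : 0 < q) :
    ∃ T δ c E : ℝ, 0 < c ∧ 0 < E ∧ ∀ f : L2R, ‖f‖ = 1 → |pMean p f| ≤ A →
      pDispersion p f ≤ ENNReal.ofReal A → pDispersion q (𝓕 f : L2R) ≤ ENNReal.ofReal A →
      ∃ j : ℤ, c ≤ ‖inner ℂ (windowExp (-T) T (δ * j)) f‖ ∧
        ∀ x, ‖inner ℂ (windowExp 0 1 x) (𝓕 f : L2R)‖ ^ 2 * (1 + |(j : ℝ)|) ^ q ≤ E := by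
  have hAtop : ENNReal.ofReal A ^ 2 ≠ ∞ := by finiteness
  have hε : ENNReal.ofReal (1 / 16) ≠ 0 := by simp
  obtain ⟨M, hM0, hM⟩ := exists_radius_tail_le hp hAtop hε
  obtain ⟨R, hR0, hR⟩ := exists_radius_tail_le hq hAtop hε
  have hT : 0 < M + A := by positivity
  set c := 1 / (4 * (R + 1)) with hc
  have hc0 : 0 < c := by positivity
  have hcR : 8 * R * c ^ 2 ≤ 1 := by
    rw [hc, div_pow, one_pow, mul_one_div, div_le_one (by positivity)]
    nlinarith
  obtain ⟨δ₀, hδ₀, hLip⟩ := exists_forall_norm_windowExp_sub_le hT (half_pos hc0)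
  -- `δ₀` limits the loss in correlation from rounding to the grid to `c / 2`; the cap `1` keeps the
  -- rounding error in frequency below the `1` in `|m| + R + 1`.
  set δ := min δ₀ 1
  have hδ0 : 0 < δ := lt_min hδ₀ one_pos
  have hδ1 : δ ≤ 1 := min_le_right _ _
  refine ⟨M + A, δ, c / 2, ((R + 2) / δ) ^ q * (4 ^ q * (1 + A ^ 2)), half_pos hc0,
    by positivity, fun f hf hmean hdp hdq ↦ ?_⟩
  have hmass : ∀ g : L2R, ‖g‖ = 1 → ∫⁻ t, ‖g t‖ₑ ^ 2 = 1 := fun g hg ↦ by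
    rw [lintegral_enorm_sq_eq, ← ofReal_norm, hg]; simp
  have hFf : ‖(𝓕 f : L2R)‖ = 1 := by rw [Lp.norm_fourier_eq, hf]
  have hmp := powerMoment_pMean_le hp (Lp.aestronglyMeasurable f) (hmass f hf) hdp
  have hmq := powerMoment_pMean_le hq (Lp.aestronglyMeasurable _) (hmass _ hFf) hdq
  set a := pMean p f
  set m := pMean q (𝓕 f : L2R)
  obtain ⟨ξ, hξ, hcξ⟩ := exists_le_norm_inner_windowExp (T := M + A) (R := R) (m := m) hf hc0 hcR
    (hM f a hmp _ measurableSet_Icc.compl fun t ht ↦ by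
      by_contra! h
      rw [abs_lt] at h
      rw [abs_le] at hmean
      exact ht ⟨by linarith, by linarith⟩)
    (hR _ m hmq _ measurableSet_Icc.compl fun t ht ↦ by
      by_contra! h
      rw [abs_lt] at h
      exact ht ⟨by linarith, by linarith⟩)
  refine ⟨⌊ξ / δ⌋, ?_, fun x ↦ ?_⟩ <;> set j := ⌊ξ / δ⌋
  all_goals
    have hj1 : δ * j ≤ ξ := by
      have := (le_div_iff₀ hδ0).1 (Int.floor_le (ξ / δ))
      linarith
    have hj2 : ξ ≤ δ * j + δ := by
      have := (div_lt_iff₀ hδ0).1 (Int.lt_floor_add_one (ξ / δ))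
      linarith
  · have h1 := hLip ξ (δ * j) (by
      rw [abs_of_nonneg (by linarith)]
      linarith [min_le_left δ₀ 1])
    have h2 := norm_inner_le_norm (𝕜 := ℂ)
      (windowExp (-(M + A)) (M + A) ξ - windowExp (-(M + A)) (M + A) (δ * j)) f
    rw [inner_sub_left, hf, mul_one] at h2
    have h3 := norm_sub_norm_le (inner ℂ (windowExp (-(M + A)) (M + A) ξ) f)
      (inner ℂ (windowExp (-(M + A)) (M + A) (δ * j)) f)
    linarith
  · have h1 := norm_inner_windowExp_sq_mul_rpow_le hq (sq_nonneg A) hFf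
      (by rwa [ENNReal.ofReal_pow hA.le]) x
    have h2 : 1 + |(j : ℝ)| ≤ (R + 2) / δ * (1 + |m|) := by
      have h4 : δ * |(j : ℝ)| ≤ |m| + R + 1 := by
        rw [← abs_of_pos hδ0, ← abs_mul]
        refine abs_le.2 ⟨?_, ?_⟩ <;> linarith [hξ.1, hξ.2, le_abs_self m, neg_abs_le m]
      rw [div_mul_eq_mul_div, le_div_iff₀ hδ0]
      nlinarith [abs_nonneg m]
    calc _ ≤ ‖inner ℂ (windowExp 0 1 x) (𝓕 f : L2R)‖ ^ 2 *
            ((R + 2) / δ * (1 + |m|)) ^ q := by gcongr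
      _ = ((R + 2) / δ) ^ q *
            (‖inner ℂ (windowExp 0 1 x) (𝓕 f : L2R)‖ ^ 2 * (1 + |m|) ^ q) := by
          rw [Real.mul_rpow (by positivity) (by positivity)]; ring
      _ ≤ _ := by gcongr

end Decay

/-! ### Summability along the grid. -/

section Summability

theorem summable_one_add_abs_int_rpow {b : ℝ} (hb : 1 < b) :
    Summable fun j : ℤ ↦ (1 + |(j : ℝ)|) ^ (-b) := by
  -- At `j = 0` the comparison series has the term `0 ^ (-b) = 0`, so the missing `1` is added
  -- separately.
  have h0 : Summable fun j : ℤ ↦ if j = 0 then (1 : ℝ) else 0 :=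
    summable_of_ne_finset_zero (s := {0}) fun j hj ↦ by simpa using hj
  refine Summable.of_nonneg_of_le (fun j ↦ by positivity) (fun j ↦ ?_)
    ((Real.summable_abs_int_rpow hb).add h0)
  rcases eq_or_ne j 0 with rfl | hj
  · simp [Real.zero_rpow (by linarith : -b ≠ 0)]
  · rw [if_neg hj, add_zero]
    exact Real.rpow_le_rpow_of_nonpos (by simpa using hj) (by linarith) (by linarith)

/-- If an indexed family satisfies an upper `ℓˢ` bound against uniformly bounded test vectors
`u j`, and each `e n` correlates with `u (j n)`, then summability transfers along `j`. -/
theorem summable_comp_of_le_norm_inner {B s c N : ℝ} (hB : 0 < B) (hs : 0 < s) (hc : 0 < c)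
    {e : ℕ → L2R}
    (hlower : ∀ f : L2R, ENNReal.ofReal B * (∑' n, ‖inner ℂ (e n) f‖ₑ ^ s) ^ (1 / s) ≤ ‖f‖ₑ)
    {u : ℤ → L2R} (hu : ∀ k, ‖u k‖ ≤ N) {j : ℕ → ℤ} (hj : ∀ n, c ≤ ‖inner ℂ (e n) (u (j n))‖)
    {φ : ℤ → ℝ} (hφ : Summable φ) (hφ0 : ∀ k, 0 ≤ φ k) : Summable fun n ↦ φ (j n) := by
  have hB0 : ENNReal.ofReal B ≠ 0 := by simpa using hB
  have hc0 : ENNReal.ofReal c ^ s ≠ 0 := by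
    have : 0 < ENNReal.ofReal c ^ s := ENNReal.rpow_pos (by simpa using hc) ENNReal.ofReal_ne_top
    exact this.ne'
  have hct : ENNReal.ofReal c ^ s ≠ ∞ := ENNReal.rpow_ne_top_of_nonneg hs.le ENNReal.ofReal_ne_top
  set D := (ENNReal.ofReal N / ENNReal.ofReal B) ^ s with hD
  have hDt : D ≠ ∞ :=
    ENNReal.rpow_ne_top_of_nonneg hs.le (ENNReal.div_ne_top ENNReal.ofReal_ne_top hB0)
  have hsum : ∀ k, ∑' n, ‖inner ℂ (e n) (u k)‖ₑ ^ s ≤ D := by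
    intro k
    have h1 : (∑' n, ‖inner ℂ (e n) (u k)‖ₑ ^ s) ^ (1 / s) ≤
        ENNReal.ofReal N / ENNReal.ofReal B := by
      rw [ENNReal.le_div_iff_mul_le (Or.inl hB0) (Or.inl ENNReal.ofReal_ne_top), mul_comm]
      refine (hlower (u k)).trans ?_
      rw [← ofReal_norm]
      exact ENNReal.ofReal_le_ofReal (hu k)
    rw [one_div] at h1
    exact (ENNReal.rpow_inv_le_iff hs).1 h1
  -- Double counting: bound each summand below by the single term `k = j n`, then exchange the sums.
  have hle : ENNReal.ofReal c ^ s * ∑' n, ENNReal.ofReal (φ (j n)) ≤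
      (∑' k, ENNReal.ofReal (φ k)) * D := by
    calc _ = ∑' n, ENNReal.ofReal (φ (j n)) * ENNReal.ofReal c ^ s := by
          rw [ENNReal.tsum_mul_right, mul_comm]
      _ ≤ ∑' n, ∑' k, ENNReal.ofReal (φ k) * ‖inner ℂ (e n) (u k)‖ₑ ^ s := by
          refine ENNReal.tsum_le_tsum fun n ↦ le_trans ?_ (ENNReal.le_tsum (j n))
          gcongr
          rw [← ofReal_norm]
          exact ENNReal.ofReal_le_ofReal (hj n)
      _ = ∑' k, ENNReal.ofReal (φ k) * ∑' n, ‖inner ℂ (e n) (u k)‖ₑ ^ s := by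
          rw [ENNReal.tsum_comm]
          simp_rw [ENNReal.tsum_mul_left]
      _ ≤ ∑' k, ENNReal.ofReal (φ k) * D := by
          refine ENNReal.tsum_le_tsum fun k ↦ ?_
          gcongr
          exact hsum k
      _ = _ := ENNReal.tsum_mul_right
  have hfin : ∑' n, ENNReal.ofReal (φ (j n)) ≠ ∞ := by
    intro htop
    rw [htop, ENNReal.mul_top hc0, top_le_iff] at hle
    exact ENNReal.mul_ne_top hφ.tsum_ofReal_ne_top hDt hle
  refine (ENNReal.summable_toReal hfin).congr fun n ↦ ?_
  exact ENNReal.toReal_ofReal (hφ0 _)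

end Summability

/-! ### The contradiction. -/

theorem theorem4p2 (A B C p q r s : ℝ) (hA : 0 < A) (hB : 0 < B) (hC : 0 < C)
    (hp : 1 < p) (hq : 1 < q) (hr : 0 < r) (hs : 0 < s) (hqr : 2 < q * r)
    (e : ℕ → L2R) (he : ∀ n, ‖e n‖ = 1)
    (hlower : ∀ f : L2R,
      ENNReal.ofReal B * (∑' n, ‖inner ℂ (e n) f‖ₑ ^ s) ^ (1 / s) ≤ ‖f‖ₑ)
    (hupper : ∀ f : L2R,
      ‖f‖ₑ ≤ ENNReal.ofReal C * (∑' n, ‖inner ℂ (e n) f‖ₑ ^ r) ^ (1 / r)) :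
    ¬ ∀ n, |pMean p (e n)| ≤ A ∧
      pDispersion p (e n) ≤ ENNReal.ofReal A ∧
      pDispersion q (𝓕 (e n) : L2R) ≤ ENNReal.ofReal A := by
  intro hloc
  obtain ⟨T, δ, c, E, hc, hE, hgrid⟩ := exists_frequency_grid hA (by linarith : 0 < p)
    (by linarith : 0 < q)
  choose j hj hdecay using fun n ↦
    hgrid (e n) (he n) (hloc n).1 (hloc n).2.1 (hloc n).2.2
  have hsum : Summable fun n ↦ E ^ (r / 2) * (1 + |(j n : ℝ)|) ^ (-(q * r / 2)) := by
    refine Summable.mul_left _ (summable_comp_of_le_norm_inner hB hs hc hlower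
      -- The sign of `T` is not recorded by the grid lemma, hence the `max` with `0`.
      (u := fun k ↦ windowExp (-T) T (δ * k)) (N := √(max (T - -T) 0)) (fun k ↦ ?_) (fun n ↦ ?_)
      (φ := fun k : ℤ ↦ (1 + |(k : ℝ)|) ^ (-(q * r / 2)))
      (summable_one_add_abs_int_rpow (by linarith)) fun k ↦ by positivity)
    · refine Real.le_sqrt_of_sq_le ?_
      have h := congrArg ENNReal.toReal (enorm_windowExp_sq (-T) T (δ * k))
      rw [ENNReal.toReal_pow, toReal_enorm] at h
      rw [h, ENNReal.toReal_ofReal']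
    · rw [norm_inner_symm]
      exact hj n
  set f : ℝ → L2R := fun x ↦ 𝓕⁻ (windowExp 0 1 x) with hf
  have hinner : ∀ n x, ‖inner ℂ (e n) (f x)‖ = ‖inner ℂ (windowExp 0 1 x) (𝓕 (e n) : L2R)‖ := by
    intro n x
    rw [norm_inner_symm, ← Lp.inner_fourier_eq, hf]
    simp only [FourierTransform.fourier_fourierInv_eq]
  have hbound : ∀ n x, ‖inner ℂ (e n) (f x)‖ ^ r ≤
      E ^ (r / 2) * (1 + |(j n : ℝ)|) ^ (-(q * r / 2)) := by
    intro n x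
    have h1 := hdecay n x
    rw [← hinner] at h1
    have hpos : 0 < 1 + |(j n : ℝ)| := by positivity
    calc ‖inner ℂ (e n) (f x)‖ ^ r = (‖inner ℂ (e n) (f x)‖ ^ 2) ^ (r / 2) := by
          rw [← Real.rpow_natCast, ← Real.rpow_mul (norm_nonneg _)]
          congr 1; push_cast; ring
      _ ≤ (E * (1 + |(j n : ℝ)|) ^ (-q)) ^ (r / 2) := by
          refine Real.rpow_le_rpow (by positivity) ?_ (by positivity)
          rwa [Real.rpow_neg hpos.le, ← div_eq_mul_inv, le_div_iff₀ (by positivity)]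
      _ = _ := by
          rw [Real.mul_rpow hE.le (by positivity), ← Real.rpow_mul hpos.le]
          congr 2; ring
  have hsumx : ∀ x, Summable fun n ↦ ‖inner ℂ (e n) (f x)‖ ^ r := fun x ↦
    Summable.of_nonneg_of_le (fun n ↦ by positivity) (fun n ↦ hbound n x) hsum
  have hlim : Tendsto (fun x ↦ ∑' n, ‖inner ℂ (e n) (f x)‖ ^ r) (cocompact ℝ) (𝓝 0) := by
    rw [← tsum_zero (α := ℝ) (β := ℕ)]
    refine tendsto_tsum_of_dominated_convergence hsum (fun n ↦ ?_)
      (Eventually.of_forall fun x n ↦ ?_)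
    -- Riemann–Lebesgue: as a function of `x`, the coefficient is the Fourier integral of the
    -- transform of `e n` restricted to `[0, 1]`.
    · have h1 := (Real.zero_at_infty_fourier
        ((Set.Icc 0 1).indicator ((𝓕 (e n) : L2R) : ℝ → ℂ))).norm
      rw [norm_zero] at h1
      have h2 := h1.rpow_const (p := r) (Or.inr hr.le)
      rw [Real.zero_rpow hr.ne'] at h2
      exact h2.congr fun x ↦ by rw [hinner, inner_windowExp]
    · rw [Real.norm_of_nonneg (by positivity)]
      exact hbound n x
  have hone : ∀ x, 1 ≤ C * (∑' n, ‖inner ℂ (e n) (f x)‖ ^ r) ^ (1 / r) := by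
    intro x
    have hS0 : 0 ≤ ∑' n, ‖inner ℂ (e n) (f x)‖ ^ r := tsum_nonneg fun n ↦ by positivity
    have hw : ‖windowExp 0 1 x‖ₑ ^ 2 = 1 := by rw [enorm_windowExp_sq]; simp
    have hnorm : ‖f x‖ₑ = 1 := by
      have h1 : ‖f x‖ = ‖windowExp 0 1 x‖ := by
        rw [← Lp.norm_fourier_eq, hf]
        simp only [FourierTransform.fourier_fourierInv_eq]
      rw [← ofReal_norm, h1, ofReal_norm]
      exact le_antisymm ((ENNReal.pow_le_pow_left_iff two_ne_zero).1 (by rw [hw, one_pow]))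
        ((ENNReal.pow_le_pow_left_iff two_ne_zero).1 (by rw [hw, one_pow]))
    have h2 := hupper (f x)
    have h3 : ∑' n, ‖inner ℂ (e n) (f x)‖ₑ ^ r =
        ENNReal.ofReal (∑' n, ‖inner ℂ (e n) (f x)‖ ^ r) := by
      rw [ENNReal.ofReal_tsum_of_nonneg (fun n ↦ by positivity) (hsumx x)]
      refine tsum_congr fun n ↦ ?_
      rw [← ofReal_norm, ENNReal.ofReal_rpow_of_nonneg (norm_nonneg _) hr.le]
    rw [hnorm, h3, ENNReal.ofReal_rpow_of_nonneg hS0 (by positivity), ← ENNReal.ofReal_mul hC.le,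
      ← ENNReal.ofReal_one, ENNReal.ofReal_le_ofReal_iff (by positivity)] at h2
    exact h2
  have hlim' := (hlim.rpow_const (p := 1 / r) (Or.inr (by positivity))).const_mul C
  rw [Real.zero_rpow (by positivity), mul_zero] at hlim'
  have := ge_of_tendsto hlim' (Eventually.of_forall hone)
  norm_num at this
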